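/- Let $q\ge 1$, $b\ge 1$, $n\ge b+1$ be integers, let $\Sigma_q=\{0,1,\dots,q-1\}$, and let $\mathbf{x}=x_1x_2\cdots x_n\in\Sigma_q^n$. Let $\mathcal{L}_1^b(\mathbf{x})\subseteq\Sigma_q^n$ be the radius-one fixed-length $b$-burst Levenshtein ball, i.e. the set of all sequences of length $n$ obtainable from $\mathbf{x}$ by deleting one block of $b$ consecutive symbols and then inserting one block of $b$ consecutive symbols of $\Sigma_q$ at an arbitrary position. For integers $u,v$ let $[u,v]=\{u,u+1,\dots,v\}$, which is empty if $u>v$. For $m\ge1$, call a substring $\mathbf{x}_{[u,v]}=x_u\cdots x_v$ $m$-periodic if $x_t=x_{t+m}$ whenever $u\le t$ and $t+m\le v$ (so a substring of length at most $m$ is always $m$-periodic). A $b$-run of $\mathbf{x}$ is a non-empty substring $\mathbf{x}_{[u,v]}$, $[u,v]\subseteq[1,n]$, that is $b$-periodic and is not properly contained in a longer $b$-periodic substring $\mathbf{x}_{[u',v']}$, $[u,v]\subsetneq[u',v']\subseteq[1,n]$; let $r_b(\mathbf{x})$ be the number of $b$-runs of $\mathbf{x}$, that is, the number of such intervals $[u,v]$.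 For $j\in[1,b-1]$ put $$f_{b,j}(\mathbf{x})=\bigl|\{i\in[1,n-b-j]:\ x_i\ne x_{i+b},\ x_{i+j}\ne x_{i+j+b}\}\bigr|,$$ and for $i\in[1,n-2b]$ put $$g_{b,i}(\mathbf{x})=\bigl|\{j\in[i+b,n-b]:\ x_i\ne x_{i+b},\ x_j\ne x_{j+b},\ \mathbf{x}_{[i,j+b]}\text{ is }2b\text{-periodic}\}\bigr|.$$ Then $$|\mathcal{L}_1^b(\mathbf{x})| = q^{b-1}\bigl((n-b+1)(q-1)-1\bigr)\,r_b(\mathbf{x}) + 2q^{b-1} - \sum_{j=1}^{b-1} q^{b-j-1} f_{b,j}(\mathbf{x}) - \sum_{i=1}^{n-2b} g_{b,i}(\mathbf{x}),$$ where empty sums are $0$ (the last sum is empty if $n\le 2b$). -/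

import Mathlib

open Finset

/-- The letter `x_i` of the word `x = x_1 x_2 ⋯ x_n`, for `i ∈ [1, n]` (positions are numbered from
`1`); the value is `none` at the positions outside `[1, n]`. -/
def entry {q n : ℕ} (x : Fin n → Fin q) (i : ℕ) : Option (Fin q) :=
  if h : 1 ≤ i ∧ i ≤ n then some (x ⟨i - 1, by omega⟩) else none

/-- `y` arises from `x` by one burst of `b` deletions: a block of `b` consecutive letters is
removed. -/
def BurstDeletion {α : Type*} (b : ℕ) (x y : List α) : Prop :=
  ∃ u v w : List α, v.length = b ∧ x = u ++ v ++ w ∧ y = u ++ w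

/-- `y` arises from `x` by one burst of `b` insertions: a block of `b` consecutive letters is
inserted. -/
def BurstInsertion {α : Type*} (b : ℕ) (x y : List α) : Prop :=
  ∃ u v w : List α, v.length = b ∧ x = u ++ w ∧ y = u ++ v ++ w

/-- The `b`-burst-deletion ball of radius `t`: all words obtained from `x` by `t` successive bursts
of `b` deletions. -/
def deletionBall {α : Type*} (b : ℕ) : ℕ → List α → Set (List α)
  | 0, x => {x}
  | t + 1, x => {z | ∃ y, BurstDeletion b x y ∧ z ∈ deletionBall b t y}

/-- The `b`-burst-insertion ball of radius `t`: all words obtained from `x` by `t` successive bursts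
of `b` insertions. -/
def insertionBall {α : Type*} (b : ℕ) : ℕ → List α → Set (List α)
  | 0, x => {x}
  | t + 1, x => {z | ∃ y, BurstInsertion b x y ∧ z ∈ insertionBall b t y}

/-- The fixed-length `b`-burst Levenshtein ball of radius `t` centred at `x`: all words of length
`n` obtained from `x` by `t` bursts of `b` deletions followed by `t` bursts of `b` insertions. -/
def levenshteinBall {q n : ℕ} (b t : ℕ) (x : Fin n → Fin q) : Set (Fin n → Fin q) :=
  {z | ∃ y ∈ deletionBall b t (List.ofFn x), List.ofFn z ∈ insertionBall b t y}

/-- The substring `x_{[s, e]} = x_s ⋯ x_e` is `m`-periodic; this holds automatically when its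
length is at most `m`. Used only for `1 ≤ s` and `e ≤ n`. -/
def SubstringPeriodic {q n : ℕ} (m : ℕ) (x : Fin n → Fin q) (s e : ℕ) : Prop :=
  ∀ t, s ≤ t → t + m ≤ e → entry x t = entry x (t + m)

/-- `[s, e] ⊆ [1, n]` is a (non-empty) interval of positions carrying a `b`-run of `x`: the
substring `x_{[s, e]}` is `b`-periodic, and no strictly longer substring containing it is. -/
def IsRun {q n : ℕ} (b : ℕ) (x : Fin n → Fin q) (s e : ℕ) : Prop :=
  (1 ≤ s ∧ s ≤ e ∧ e ≤ n) ∧ SubstringPeriodic b x s e ∧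
    ∀ s' e', 1 ≤ s' → s' ≤ s → e ≤ e' → e' ≤ n → SubstringPeriodic b x s' e' → s' = s ∧ e' = e

open Classical in
/-- `r_b(x)`, the number of `b`-runs of `x`, counted by their intervals of positions. -/
noncomputable def runCount {q n : ℕ} (b : ℕ) (x : Fin n → Fin q) : ℕ :=
  #{p ∈ Icc 1 n ×ˢ Icc 1 n | IsRun b x p.1 p.2}

open Classical in
/-- `f_{b,j}(x)`, the number of `i ∈ [1, n - b - j]` with `x_i ≠ x_{i+b}` and
`x_{i+j} ≠ x_{i+j+b}`. -/
noncomputable def fCount {q n : ℕ} (b j : ℕ) (x : Fin n → Fin q) : ℕ :=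
  #{i ∈ Icc 1 (n - b - j) |
    entry x i ≠ entry x (i + b) ∧ entry x (i + j) ≠ entry x (i + j + b)}

open Classical in
/-- `g_{b,i}(x)`, the number of `j ∈ [i + b, n - b]` such that `x_i ≠ x_{i+b}`, `x_j ≠ x_{j+b}` and
`x_{[i, j+b]}` is `2b`-periodic. -/
noncomputable def gCount {q n : ℕ} (b i : ℕ) (x : Fin n → Fin q) : ℕ :=
  #{j ∈ Icc (i + b) (n - b) |
    entry x i ≠ entry x (i + b) ∧ entry x j ≠ entry x (j + b) ∧
      SubstringPeriodic (2 * b) x i (j + b)}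

/-! Write `X` for `entry x`, put `m = n - b`, and call `i ∈ [1, m]` a jump when `X i ≠ X (i + b)`.
Moving the deleted block from `i` to `i + 1` changes the result exactly when `i` is a jump. The
deletion positions `1, …, m + 1` thus fall into classes ending at the jumps and at `m + 1`; the
classes correspond to the `b`-runs (`runCount_eq`).

Insertion undoes deletion, so a word `z` lies in the ball iff some deletion in `x` is also a
deletion in `z`. A single deletion result is shared by `(n - b + 1) q ^ b - (n - b) q ^ (b - 1)`
words (`card_cutShared_words`). Summing over classes overcounts the ball, and `card_cutShared`
measures the excess for each `z`. If deletions before and after the jumps `p ≤ p'` are both shared,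
with no other jumps outside `[p, p']` between them, then either `z` agrees with `x` outside the open
interval `(p', p + b)`, or `z` exchanges the blocks `[p, p']` and `[p + b, p' + b]`
(`agreeOutside_or_isSwap`). In a swap exactly two classes are shared. Without swaps the shared
positions are convex, so the shared classes outnumber by one the jumps interior to them, which are
the `p` with agreement outside `(p, p + b)`.

The agreements number `q ^ (b - 1)` for each jump. A pair of jumps admits a swap iff `x` is
`2b`-periodic on `[p, p' + b]` (`card_isSwap`); pairs at distance `0`, at distance between `1` and
`b - 1`, and at distance at least `b` give a second `q ^ (b - 1)` per jump, the `f` terms and the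
`g` terms. -/

/-! ### Block deletions shared by two sequences -/

section Cut

variable {β : Type*} {b m : ℕ} {X Z : ℕ → β}

/-- The sequence obtained from `X` by deleting the positions `s, …, s + b - 1`. -/
def cut (b s : ℕ) (X : ℕ → β) : ℕ → β := fun i => if i < s then X i else X (i + b)

theorem cut_eq_cut_iff {s s' : ℕ} (h : s ≤ s') :
    cut b s X = cut b s' X ↔ ∀ i, s ≤ i → i < s' → X i = X (i + b) := by
  constructor
  · intro e i h1 h2
    have := congr_fun e i
    simp only [cut] at this
    grind
  · intro e
    funext i
    simp only [cut]
    grind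

/-- `X` and `Z` agree outside the open interval `(p', p + b)`. -/
def AgreeOutside (b : ℕ) (X Z : ℕ → β) (p p' : ℕ) : Prop :=
  ∀ i, i ≤ p' ∨ p + b ≤ i → Z i = X i

/-- `Z` arises from `X` by exchanging the blocks `[p, p']` and `[p + b, p' + b]`, with no condition
on the positions strictly between them. -/
def IsSwap (b : ℕ) (X Z : ℕ → β) (p p' : ℕ) : Prop :=
  (∀ i < p, Z i = X i) ∧ (∀ i, p ≤ i → i ≤ p' → Z i = X (i + b) ∧ Z (i + b) = X i) ∧
    ∀ i, p' + b < i → Z i = X i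

/-- Deleting the block of `X` at `s` gives a sequence that a block deletion in `Z` also gives. -/
def CutShared (b m : ℕ) (X Z : ℕ → β) (s : ℕ) : Prop :=
  ∃ t ∈ Icc 1 (m + 1), cut b s X = cut b t Z

/-- The absence of other jumps lets `s` move to `p` and `s'` to `p' + 1`. The two results then
differ at `p` and at `p'`, so both indices lie between the deletion positions `t` and `t'` in `Z`;
the order of `t` and `t'` decides the alternative. -/
theorem agreeOutside_or_isSwap {s s' t t' p p' : ℕ} (hs : cut b s X = cut b t Z)
    (hs' : cut b s' X = cut b t' Z) (hsp : s ≤ p) (hpp : p ≤ p') (hps : p' < s')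
    (hp : X p ≠ X (p + b)) (hp' : X p' ≠ X (p' + b))
    (hJ : ∀ i, s ≤ i → i < s' → X i ≠ X (i + b) → p ≤ i ∧ i ≤ p') :
    AgreeOutside b X Z p p' ∨ IsSwap b X Z p p' := by
  have e1 : cut b s X = cut b p X := by
    rw [cut_eq_cut_iff hsp]
    intro i h1 h2
    by_contra h3
    have := hJ i h1 (by omega) h3
    omega
  have e2 : cut b (p' + 1) X = cut b s' X := by
    rw [cut_eq_cut_iff hps]
    intro i h1 h2
    by_contra h3
    have := hJ i (by omega) h2 h3
    omega
  rw [e1] at hs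
  rw [← e2] at hs'
  have h i := congr_fun hs i
  have h' i := congr_fun hs' i
  simp only [cut] at h h'
  have hp1 := h p
  have hp2 := h' p
  have hp3 := h p'
  have hp4 := h' p'
  rcases lt_trichotomy t t' with htt | htt | htt
  · left
    have ht : t ≤ p := by grind
    have ht' : p' < t' := by grind
    rintro i (hi | hi)
    · have := h' i
      grind
    · have := h (i - b)
      rw [if_neg (by omega), if_neg (by omega), Nat.sub_add_cancel (by omega)] at this
      exact this.symm
  · grind
  · right
    have ht : t' ≤ p := by grind
    have ht' : p' < t := by grind
    refine ⟨fun i hi => ?_, fun i h1 h2 => ⟨?_, ?_⟩, fun i hi => ?_⟩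
    · have := h i
      grind
    · have := h i
      grind
    · have := h' i
      grind
    · have := h' (i - b)
      rw [if_neg (by omega), if_neg (by omega), Nat.sub_add_cancel (by omega)] at this
      exact this.symm

/-- The deleted block `[s, s + b - 1]` covers every position at which the sequences may differ. -/
theorem AgreeOutside.cut_eq {p p' s : ℕ} (h : AgreeOutside b X Z p p') (h1 : p ≤ s)
    (h2 : s ≤ p' + 1) : cut b s X = cut b s Z := by
  funext i
  simp only [cut]
  split_ifs
  · exact (h i (by omega)).symm
  · exact (h _ (by omega)).symm

theorem IsSwap.cut_left_eq {p p' : ℕ} (h : IsSwap b X Z p p') (hpp : p ≤ p') :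
    cut b p X = cut b (p' + 1) Z := by
  obtain ⟨h1, h2, h3⟩ := h
  funext i
  simp only [cut]
  grind

theorem IsSwap.cut_right_eq {p p' : ℕ} (h : IsSwap b X Z p p') (hpp : p ≤ p') :
    cut b (p' + 1) X = cut b p Z := by
  obtain ⟨h1, h2, h3⟩ := h
  funext i
  simp only [cut]
  grind

/-- Since `p` and `p'` are jumps, `p` is the first and `p' + b` the last position at which `X` and
`Z` differ. -/
theorem IsSwap.unique {p p' r r' : ℕ} (h : IsSwap b X Z p p') (hr : IsSwap b X Z r r')
    (hpp : p ≤ p') (hrr : r ≤ r') (hp : X p ≠ X (p + b)) (hp' : X p' ≠ X (p' + b))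
    (hjr : X r ≠ X (r + b)) (hjr' : X r' ≠ X (r' + b)) : p = r ∧ p' = r' := by
  obtain ⟨h1, h2, h3⟩ := h
  obtain ⟨k1, k2, k3⟩ := hr
  have a1 := h2 p le_rfl hpp
  have a2 := h2 p' hpp le_rfl
  have a3 := k2 r le_rfl hrr
  have a4 := k2 r' hrr le_rfl
  constructor
  · rcases lt_trichotomy p r with hlt | hlt | hlt
    · have := k1 p hlt
      grind
    · exact hlt
    · have := h1 r hlt
      grind
  · rcases lt_trichotomy p' r' with hlt | hlt | hlt
    · have := h3 (r' + b) (by omega)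
      grind
    · exact hlt
    · have := k3 (p' + b) (by omega)
      grind

/-- A swap creates differences at `p` and `p' + b`, at distance at least `b`, too far apart for the
open interval `(s', s + b)`. -/
theorem IsSwap.not_agreeOutside {p p' s s' : ℕ} (h : IsSwap b X Z p p') (hpp : p ≤ p')
    (hss : s ≤ s') (hp : X p ≠ X (p + b)) (hp' : X p' ≠ X (p' + b)) :
    ¬ AgreeOutside b X Z s s' := by
  intro ha
  obtain ⟨h1, h2, h3⟩ := h
  have a1 := h2 p le_rfl hpp
  have a2 := h2 p' hpp le_rfl
  have b1 := ha p
  have b2 := ha (p' + b)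
  have c1 : ¬ (p ≤ s' ∨ s + b ≤ p) := fun hh => hp ((b1 hh).symm.trans a1.1)
  have c2 : ¬ (p' + b ≤ s' ∨ s + b ≤ p' + b) := fun hh => hp' (a2.2.symm.trans (b2 hh))
  omega

/-- The positions of `[1, m]` at which `X` fails to be `b`-periodic. -/
noncomputable def jumps (b m : ℕ) (X : ℕ → β) : Finset ℕ :=
  open Classical in {i ∈ Icc 1 m | X i ≠ X (i + b)}

theorem mem_jumps {i : ℕ} : i ∈ jumps b m X ↔ (1 ≤ i ∧ i ≤ m) ∧ X i ≠ X (i + b) := by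
  simp [jumps]

theorem exists_extreme_jumps {s s' u : ℕ} (hu : u ∈ jumps b m X) (h1 : s ≤ u) (h2 : u < s')
    (hs : 1 ≤ s) (hs' : s' ≤ m + 1) :
    ∃ p ∈ jumps b m X, ∃ p' ∈ jumps b m X, s ≤ p ∧ p ≤ p' ∧ p' < s' ∧ p ≤ u ∧ u ≤ p' ∧
      ∀ i, s ≤ i → i < s' → X i ≠ X (i + b) → p ≤ i ∧ i ≤ p' := by
  classical
  set S := {i ∈ jumps b m X | s ≤ i ∧ i < s'} with hS
  have huS : u ∈ S := by simp [hS, hu, h1, h2]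
  have hne : S.Nonempty := ⟨u, huS⟩
  have hm := S.min'_mem hne
  have hM := S.max'_mem hne
  have hmu := S.min'_le u huS
  have hMu := S.le_max' u huS
  replace hm := mem_filter.1 hm
  replace hM := mem_filter.1 hM
  refine ⟨_, hm.1, _, hM.1, hm.2.1, hmu.trans hMu, hM.2.2, hmu, hMu, fun i hi hi' hne' => ?_⟩
  have hiS : i ∈ S := by
    rw [hS, mem_filter, mem_jumps]
    exact ⟨⟨⟨by omega, by omega⟩, hne'⟩, hi, hi'⟩
  exact ⟨S.min'_le i hiS, S.le_max' i hiS⟩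

open Classical in
/-- A non-empty convex part of `[1, m + 1]` which is a union of classes, where the classes end
exactly at the points of `J` and at `m + 1`, has one more class end than it has internal ones. -/
theorem card_filter_of_convex {J : Finset ℕ} {T : ℕ → Prop} (hJ : J ⊆ Icc 1 m)
    (hT : ∀ s u s', 1 ≤ s → s ≤ u → u ≤ s' → s' ≤ m + 1 → T s → T s' → T u)
    (hne : ∃ s ∈ Icc 1 (m + 1), T s) (hc : ∀ i ∈ Icc 1 m, i ∉ J → T i → T (i + 1)) :
    #{s ∈ insert (m + 1) J | T s} = 1 + #{p ∈ J | T p ∧ T (p + 1)} := by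
  set S := {s ∈ Icc 1 (m + 1) | T s} with hS
  have hSne : S.Nonempty := by
    obtain ⟨s, hs, h⟩ := hne
    exact ⟨s, by simp_all⟩
  have hM := S.max'_mem hSne
  have hle := S.le_max'
  set c := S.max' hSne
  rw [hS, mem_filter, mem_Icc] at hM
  have hcJ : c ∈ insert (m + 1) J := by
    by_contra hcon
    rw [mem_insert, not_or] at hcon
    have h1 := hc c (by rw [mem_Icc]; omega) hcon.2 hM.2
    have := hle (c + 1) (by rw [hS, mem_filter, mem_Icc]; exact ⟨by omega, h1⟩)
    omega
  have : {s ∈ insert (m + 1) J | T s} = insert c {p ∈ J | T p ∧ T (p + 1)} := by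
    ext i
    simp only [mem_filter, mem_insert]
    constructor
    · rintro ⟨hi, hTi⟩
      have hi1 : 1 ≤ i ∧ i ≤ m + 1 := by
        rcases hi with rfl | hi
        · omega
        · have := mem_Icc.1 (hJ hi)
          omega
      have hic := hle i (by rw [hS, mem_filter, mem_Icc]; exact ⟨hi1, hTi⟩)
      rcases hic.eq_or_lt with h | h
      · exact Or.inl h
      · refine Or.inr ⟨?_, hTi, hT i (i + 1) c hi1.1 (by omega) h hM.1.2 hTi hM.2⟩
        rcases hi with rfl | hi
        · omega
        · exact hi
    · rintro (rfl | ⟨hi, hTi, -⟩)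
      · exact ⟨mem_insert.1 hcJ, hM.2⟩
      · exact ⟨Or.inr hi, hTi⟩
  rw [this, card_insert_of_notMem, add_comm]
  rw [mem_filter]
  rintro ⟨hcJ', -, h1⟩
  have h2 := mem_Icc.1 (hJ hcJ')
  have := hle (c + 1) (by rw [hS, mem_filter, mem_Icc]; exact ⟨by omega, h1⟩)
  omega

theorem CutShared.congr {s s' : ℕ} (h : CutShared b m X Z s) (e : cut b s X = cut b s' X) :
    CutShared b m X Z s' := by
  obtain ⟨t, ht, h⟩ := h
  exact ⟨t, ht, e ▸ h⟩

theorem CutShared.agreeOutside_or_isSwap {s s' u : ℕ} (h : CutShared b m X Z s)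
    (h' : CutShared b m X Z s') (hs : 1 ≤ s) (hs' : s' ≤ m + 1) (hu : u ∈ jumps b m X)
    (h1 : s ≤ u) (h2 : u < s') :
    ∃ p ∈ jumps b m X, ∃ p' ∈ jumps b m X, s ≤ p ∧ p ≤ p' ∧ p' < s' ∧ p ≤ u ∧ u ≤ p' ∧
      (∀ i, s ≤ i → i < s' → X i ≠ X (i + b) → p ≤ i ∧ i ≤ p') ∧
      (AgreeOutside b X Z p p' ∨ IsSwap b X Z p p') := by
  obtain ⟨t, -, e⟩ := h
  obtain ⟨t', -, e'⟩ := h'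
  obtain ⟨p, hp, p', hp', a1, a2, a3, a4, a5, a6⟩ := exists_extreme_jumps hu h1 h2 hs hs'
  exact ⟨p, hp, p', hp', a1, a2, a3, a4, a5, a6, _root_.agreeOutside_or_isSwap e e' a1 a2 a3
    (mem_jumps.1 hp).2 (mem_jumps.1 hp').2 a6⟩

/-- The pairs of jumps `p ≤ p'`. -/
noncomputable def jumpPairs (b m : ℕ) (X : ℕ → β) : Finset (ℕ × ℕ) :=
  {P ∈ jumps b m X ×ˢ jumps b m X | P.1 ≤ P.2}

theorem mem_jumpPairs {P : ℕ × ℕ} :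
    P ∈ jumpPairs b m X ↔ (P.1 ∈ jumps b m X ∧ P.2 ∈ jumps b m X) ∧ P.1 ≤ P.2 := by
  simp [jumpPairs]

-- The two shared classes are those of `p` and `p' + 1`. By uniqueness of the swap, the jumps
-- between any two shared positions have first element `p` and last element `p'`, which leaves no
-- room for a third class.
open Classical in
theorem card_cutShared_of_isSwap {p p' : ℕ} (hp : p ∈ jumps b m X) (hp' : p' ∈ jumps b m X)
    (hpp : p ≤ p') (h : IsSwap b X Z p p') :
    #{s ∈ insert (m + 1) (jumps b m X) | CutShared b m X Z s} = 2 := by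
  obtain ⟨⟨p1, pm⟩, pj⟩ := mem_jumps.1 hp
  obtain ⟨⟨p'1, p'm⟩, p'j⟩ := mem_jumps.1 hp'
  have key : ∀ s s' u, CutShared b m X Z s → CutShared b m X Z s' → 1 ≤ s → s' ≤ m + 1 →
      u ∈ jumps b m X → s ≤ u → u < s' → s ≤ p ∧ p ≤ u ∧ u ≤ p' ∧ p' < s' := by
    intro s s' u hs hs' h1 h2 hu hsu hus
    obtain ⟨r, hr, r', hr', a1, a2, a3, a4, a5, -, hor⟩ :=
      hs.agreeOutside_or_isSwap hs' h1 h2 hu hsu hus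
    rcases hor with ha | ha
    · exact absurd ha (h.not_agreeOutside hpp a2 pj p'j)
    · obtain ⟨rfl, rfl⟩ := h.unique ha hpp a2 pj p'j (mem_jumps.1 hr).2 (mem_jumps.1 hr').2
      exact ⟨a1, a4, a5, a3⟩
  have hsp : CutShared b m X Z p := ⟨p' + 1, by rw [mem_Icc]; omega, h.cut_left_eq hpp⟩
  have hsp' : CutShared b m X Z (p' + 1) := ⟨p, by rw [mem_Icc]; omega, h.cut_right_eq hpp⟩
  -- `p' + 1` need not be a class end; the least class end `c` from there on represents its class.
  set R := {s ∈ insert (m + 1) (jumps b m X) | p' + 1 ≤ s} with hR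
  have hne : R.Nonempty := ⟨m + 1, by simp [hR, p'm]⟩
  have hmem := R.min'_mem hne
  have hle := R.min'_le
  set c := R.min' hne
  rw [hR, mem_filter] at hmem
  have hcm : c ≤ m + 1 := hle _ (by simp [hR, p'm])
  have hsc : CutShared b m X Z c := by
    refine hsp'.congr ((cut_eq_cut_iff hmem.2).2 fun i h1 h2 => ?_)
    by_contra h3
    have := hle i (by
      rw [hR, mem_filter, mem_insert, mem_jumps]
      exact ⟨Or.inr ⟨by omega, h3⟩, h1⟩)
    omega
  have : {s ∈ insert (m + 1) (jumps b m X) | CutShared b m X Z s} = {p, c} := by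
    ext s
    simp only [mem_filter, mem_insert, mem_singleton]
    constructor
    · rintro ⟨hs, hsh⟩
      by_contra! hcon
      obtain ⟨hsp0, hsc0⟩ := hcon
      rcases hsp0.lt_or_gt with hlt | hlt
      · have hsJ : s ∈ jumps b m X := by
          rcases hs with rfl | hs
          · omega
          · exact hs
        have := key s p s hsh hsp (mem_jumps.1 hsJ).1.1 (by omega) hsJ le_rfl hlt
        omega
      · have hsm : s ≤ m + 1 := by
          rcases hs with rfl | hs
          · omega
          · have := (mem_jumps.1 hs).1.2
            omega
        have h1 := key p s p hsp hsh p1 hsm hp le_rfl hlt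
        have h2 := hle s (by rw [hR, mem_filter, mem_insert]; exact ⟨hs, h1.2.2.2⟩)
        have h3 : c < s := by omega
        have hcJ : c ∈ jumps b m X := by
          have := mem_insert.1 hmem.1
          rcases this with h4 | h4
          · omega
          · exact h4
        have := key p s c hsp hsh p1 hsm hcJ (by omega) h3
        omega
    · rintro (rfl | rfl)
      · exact ⟨Or.inr hp, hsp⟩
      · exact ⟨mem_insert.1 hmem.1, hsc⟩
  rw [this, card_pair (by omega)]

open Classical in
theorem card_cutShared (b m : ℕ) (X Z : ℕ → β) :
    #{s ∈ insert (m + 1) (jumps b m X) | CutShared b m X Z s} =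
      (if ∃ s ∈ Icc 1 (m + 1), CutShared b m X Z s then 1 else 0) +
        #{p ∈ jumps b m X | AgreeOutside b X Z p p} +
        #{P ∈ jumpPairs b m X | IsSwap b X Z P.1 P.2} := by
  have hagree : ∀ p ∈ jumps b m X, AgreeOutside b X Z p p →
      CutShared b m X Z p ∧ CutShared b m X Z (p + 1) := by
    intro p hp h
    have := (mem_jumps.1 hp).1
    exact ⟨⟨p, by rw [mem_Icc]; omega, h.cut_eq le_rfl (by omega)⟩,
      ⟨p + 1, by rw [mem_Icc]; omega, h.cut_eq (by omega) (by omega)⟩⟩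
  by_cases hsw : ∃ P ∈ jumpPairs b m X, IsSwap b X Z P.1 P.2
  · obtain ⟨⟨p, p'⟩, hP, h⟩ := hsw
    obtain ⟨⟨hp, hp'⟩, hpp⟩ := mem_jumpPairs.1 hP
    dsimp only at hp hp' hpp h
    have pj := (mem_jumps.1 hp).2
    have p'j := (mem_jumps.1 hp').2
    have e1 : #{P ∈ jumpPairs b m X | IsSwap b X Z P.1 P.2} = 1 := by
      rw [card_eq_one]
      refine ⟨(p, p'), ?_⟩
      ext ⟨r, r'⟩
      rw [mem_filter, mem_singleton]
      constructor
      · rintro ⟨hr, hr'⟩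
        obtain ⟨⟨hr1, hr2⟩, hrr⟩ := mem_jumpPairs.1 hr
        obtain ⟨rfl, rfl⟩ := h.unique hr' hpp hrr pj p'j (mem_jumps.1 hr1).2 (mem_jumps.1 hr2).2
        rfl
      · intro e
        rw [e]
        exact ⟨hP, h⟩
    have e2 : #{p ∈ jumps b m X | AgreeOutside b X Z p p} = 0 := by
      rw [card_eq_zero, filter_eq_empty_iff]
      intro s _
      exact h.not_agreeOutside hpp le_rfl pj p'j
    have e3 : ∃ s ∈ Icc 1 (m + 1), CutShared b m X Z s := by
      have h1 := (mem_jumps.1 hp).1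
      have h2 := (mem_jumps.1 hp').1
      exact ⟨p, by rw [mem_Icc]; omega, p' + 1, by rw [mem_Icc]; omega, h.cut_left_eq hpp⟩
    rw [card_cutShared_of_isSwap hp hp' hpp h, e1, e2, if_pos e3]
  · have e1 : #{P ∈ jumpPairs b m X | IsSwap b X Z P.1 P.2} = 0 := by
      rw [card_eq_zero, filter_eq_empty_iff]
      exact fun P hP h => hsw ⟨P, hP, h⟩
    have key : ∀ s s' u, CutShared b m X Z s → CutShared b m X Z s' → 1 ≤ s → s' ≤ m + 1 →
        u ∈ jumps b m X → s ≤ u → u < s' → ∃ p p', s ≤ p ∧ p ≤ u ∧ u ≤ p' ∧ p' < s' ∧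
        (∀ i, s ≤ i → i < s' → X i ≠ X (i + b) → p ≤ i ∧ i ≤ p') ∧ AgreeOutside b X Z p p' := by
      intro s s' u hs hs' h1 h2 hu hsu hus
      obtain ⟨r, hr, r', hr', a1, a2, a3, a4, a5, a6, hor⟩ :=
        hs.agreeOutside_or_isSwap hs' h1 h2 hu hsu hus
      rcases hor with ha | ha
      · exact ⟨r, r', a1, a4, a5, a3, a6, ha⟩
      · exact absurd ⟨(r, r'), mem_jumpPairs.2 ⟨⟨hr, hr'⟩, a2⟩, ha⟩ hsw
    rw [e1, add_zero]
    split_ifs with hne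
    · rw [card_filter_of_convex (T := CutShared b m X Z) (J := jumps b m X)
        (fun i hi => mem_Icc.2 (mem_jumps.1 hi).1) ?_ hne ?_]
      · congr 2
        ext p
        simp only [mem_filter, and_congr_right_iff]
        intro hp
        refine ⟨fun h => ?_, hagree p hp⟩
        have hpm := (mem_jumps.1 hp).1
        -- The only jump in `[p, p + 1)` is `p`, which forces `r = r' = p`.
        obtain ⟨r, r', a1, a2, a3, a4, -, a6⟩ :=
          key p (p + 1) p h.1 h.2 hpm.1 (by omega) hp le_rfl (by omega)
        obtain rfl : r = p := by omega
        obtain rfl : r' = r := by omega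
        exact a6
      · intro s u s' h1 hsu hus h2 hs hs'
        -- Convexity: with a jump before `u`, agreement outside `(r', r + b)` makes `u` shared
        -- directly if `u ≤ r' + 1`, and otherwise `u` is in the class of `r' + 1`. With no such
        -- jump, `u` is in the class of `s`.
        by_cases hJ : ∃ v ∈ jumps b m X, s ≤ v ∧ v < u
        · obtain ⟨v, hv, hsv, hvu⟩ := hJ
          obtain ⟨r, r', a1, a2, a3, a4, a5, a6⟩ :=
            key s s' v hs hs' h1 h2 hv hsv (by omega)
          by_cases hur : u ≤ r' + 1
          · exact ⟨u, by rw [mem_Icc]; omega, a6.cut_eq (by omega) hur⟩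
          · refine CutShared.congr (s := r' + 1) ⟨r' + 1, by rw [mem_Icc]; omega,
              a6.cut_eq (by omega) le_rfl⟩ ((cut_eq_cut_iff (by omega)).2 fun i i1 i2 => ?_)
            by_contra i3
            have := a5 i (by omega) (by omega) i3
            omega
        · refine hs.congr ((cut_eq_cut_iff hsu).2 fun i i1 i2 => ?_)
          by_contra i3
          exact hJ ⟨i, mem_jumps.2 ⟨by omega, i3⟩, i1, i2⟩
      · intro i hi hiJ hs
        refine hs.congr ((cut_eq_cut_iff (by omega)).2 fun j j1 j2 => ?_)
        obtain rfl : j = i := by omega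
        by_contra i3
        exact hiJ (mem_jumps.2 ⟨mem_Icc.1 hi, i3⟩)
    · rw [zero_add]
      have h1 : ∀ s ∈ insert (m + 1) (jumps b m X), ¬ CutShared b m X Z s := by
        intro s hs h
        refine hne ⟨s, ?_, h⟩
        rw [mem_Icc]
        rcases mem_insert.1 hs with rfl | hs
        · omega
        · have := (mem_jumps.1 hs).1
          omega
      rw [filter_false_of_mem h1, filter_false_of_mem]
      intro p hp h
      exact h1 p (mem_insert_of_mem hp) (hagree p hp h).1

end Cut

/-! ### Words as sequences, and the number of words sharing a deletion -/

section Words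

variable {q n b : ℕ}

theorem entry_succ (x : Fin n → Fin q) (i : ℕ) : entry x (i + 1) = (List.ofFn x)[i]? := by
  rw [List.getElem?_ofFn, entry]
  by_cases h : i < n
  · rw [dif_pos (by omega), dif_pos h]
    simp
  · rw [dif_neg (by omega), dif_neg h]

theorem entry_fin_succ (x : Fin n → Fin q) (i : Fin n) : entry x (i + 1) = some (x i) := by
  rw [entry_succ]
  simp

theorem entry_eq_none_iff {x : Fin n → Fin q} {i : ℕ} : entry x i = none ↔ i ∉ Icc 1 n := by
  simp [entry]

theorem burstDeletion_iff {α : Type*} {l y : List α} :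
    BurstDeletion b l y ↔ ∃ s, s + b ≤ l.length ∧ y = l.take s ++ l.drop (s + b) := by
  constructor
  · rintro ⟨u, v, w, hv, rfl, rfl⟩
    refine ⟨u.length, by simp [hv], ?_⟩
    rw [← hv, ← List.length_append, List.drop_left, List.append_assoc, List.take_left]
  · rintro ⟨s, hs, rfl⟩
    refine ⟨l.take s, (l.drop s).take b, l.drop (s + b), ?_, ?_, rfl⟩
    · simp
      omega
    · rw [List.append_assoc, ← List.drop_drop, List.take_append_drop, List.take_append_drop]

theorem getElem?_take_append_drop {α : Type*} {l : List α} {s : ℕ} (hs : s ≤ l.length) (i : ℕ) :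
    (l.take s ++ l.drop (s + b))[i]? = if i < s then l[i]? else l[i + b]? := by
  split_ifs with h
  · rw [List.getElem?_append_left (by simp; omega), List.getElem?_take_of_lt h]
  · rw [List.getElem?_append_right (by simp; omega), List.getElem?_drop, List.length_take,
      min_eq_left hs]
    congr 1
    omega

theorem take_append_drop_eq_iff {x z : Fin n → Fin q} {s t : ℕ} (hs : s ≤ n) (ht : t ≤ n) :
    (List.ofFn x).take s ++ (List.ofFn x).drop (s + b) =
      (List.ofFn z).take t ++ (List.ofFn z).drop (t + b) ↔
    cut b (s + 1) (entry x) = cut b (t + 1) (entry z) := by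
  have hx := @getElem?_take_append_drop b _ (List.ofFn x) s (by simpa using hs)
  have hz := @getElem?_take_append_drop b _ (List.ofFn z) t (by simpa using ht)
  have e : ∀ (y : Fin n → Fin q) (r i : ℕ), cut b (r + 1) (entry y) (i + 1) =
      if i < r then (List.ofFn y)[i]? else (List.ofFn y)[i + b]? := by
    intro y r i
    simp only [cut, Nat.add_lt_add_iff_right, add_right_comm i 1 b, entry_succ]
  rw [List.ext_getElem?_iff, funext_iff]
  constructor
  · rintro h (_ | i)
    -- Index `0` lies outside the word, so both sides are `none`.
    · simp [cut, entry]
    · rw [e, e, ← hx, ← hz, h]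
  · intro h i
    rw [hx, hz, ← e, ← e, h]

theorem mem_levenshteinBall_one {x z : Fin n → Fin q} (hn : b ≤ n) :
    z ∈ levenshteinBall b 1 x ↔
      ∃ s ∈ Icc 1 (n - b + 1), CutShared b (n - b) (entry x) (entry z) s := by
  have e1 : z ∈ levenshteinBall b 1 x ↔
      ∃ y, BurstDeletion b (List.ofFn x) y ∧ BurstDeletion b (List.ofFn z) y := by
    simp only [levenshteinBall, deletionBall, insertionBall, BurstInsertion, BurstDeletion,
      Set.mem_ofPred_eq, Set.mem_singleton_iff]
    constructor
    · rintro ⟨y, ⟨_, h1, rfl⟩, _, h2, rfl⟩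
      obtain ⟨u, v, w, h3, h4, h5⟩ := h2
      exact ⟨y, h1, u, v, w, h3, h5, h4⟩
    · rintro ⟨y, h1, u, v, w, h3, h5, h4⟩
      exact ⟨y, ⟨y, h1, rfl⟩, _, ⟨u, v, w, h3, h4, h5⟩, rfl⟩
  rw [e1]
  simp only [burstDeletion_iff, List.length_ofFn, CutShared]
  constructor
  · rintro ⟨y, ⟨s, hs, rfl⟩, t, ht, h⟩
    exact ⟨s + 1, by rw [mem_Icc]; omega, t + 1, by rw [mem_Icc]; omega,
      (take_append_drop_eq_iff (by omega) (by omega)).1 h⟩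
  · rintro ⟨s, hs, t, ht, h⟩
    obtain ⟨s, rfl⟩ := Nat.exists_eq_add_of_le' (mem_Icc.1 hs).1
    obtain ⟨t, rfl⟩ := Nat.exists_eq_add_of_le' (mem_Icc.1 ht).1
    rw [mem_Icc] at hs ht
    exact ⟨_, ⟨s, by omega, rfl⟩, t, by omega,
      (take_append_drop_eq_iff (by omega) (by omega)).2 h⟩

-- Only the letters at positions in `S` are free. `W` must avoid `none` at the prescribed positions,
-- as no word takes that value inside `[1, n]`.
open Classical in
theorem card_words_prescribed {W : ℕ → Option (Fin q)} {S : Finset ℕ} (hS : S ⊆ Icc 1 n)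
    (hW : ∀ i ∈ Icc 1 n, i ∉ S → W i ≠ none) :
    #{z : Fin n → Fin q | ∀ i ∈ Icc 1 n, i ∉ S → entry z i = W i} = q ^ #S := by
  have e : ({z : Fin n → Fin q | ∀ i ∈ Icc 1 n, i ∉ S → entry z i = W i} : Finset _) =
      Fintype.piFinset fun i : Fin n => {a | (i : ℕ) + 1 ∉ S → some a = W (i + 1)} := by
    ext z
    simp only [mem_filter, mem_univ, true_and, Fintype.mem_piFinset]
    constructor
    · intro h i hi
      rw [← entry_fin_succ]
      exact h _ (by rw [mem_Icc]; omega) hi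
    · intro h i hi hiS
      rw [mem_Icc] at hi
      obtain ⟨i, rfl⟩ := Nat.exists_eq_add_of_le' hi.1
      have := h ⟨i, by omega⟩ hiS
      rw [← this]
      exact entry_fin_succ z ⟨i, by omega⟩
  have hcard : ∀ i : Fin n, #{a : Fin q | (i : ℕ) + 1 ∉ S → some a = W (i + 1)} =
      if (i : ℕ) + 1 ∈ S then q else 1 := by
    intro i
    split_ifs with h
    · simp [h]
    · obtain ⟨a, ha⟩ := Option.ne_none_iff_exists.1 (hW (i + 1) (by rw [mem_Icc]; omega) h)
      simp only [h, not_false_eq_true, forall_const, ← ha, Option.some.injEq]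
      rw [card_eq_one]
      exact ⟨a, by ext; simp⟩
  rw [e, Fintype.card_piFinset, prod_congr rfl fun i _ => hcard i, prod_ite, prod_const_one,
    mul_one, prod_const]
  congr 1
  refine card_bij (fun i _ => (i : ℕ) + 1) (by simp) ?_ ?_
  · intro i _ j _ hij
    ext
    omega
  · intro j hj
    have := mem_Icc.1 (hS hj)
    exact ⟨⟨j - 1, by omega⟩, by simp [Nat.sub_add_cancel this.1, hj], by simp; omega⟩

open Classical in
theorem card_agreeOutside (x : Fin n → Fin q) {p : ℕ} (hp : p ∈ jumps b (n - b) (entry x)) :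
    #{z : Fin n → Fin q | AgreeOutside b (entry x) (entry z) p p} = q ^ (b - 1) := by
  have hpm := (mem_jumps.1 hp).1
  have h := card_words_prescribed (n := n) (W := entry x) (S := Ioo p (p + b))
    (fun i hi => by rw [mem_Ioo] at hi; rw [mem_Icc]; omega)
    (fun i hi _ => by rw [Ne, entry_eq_none_iff]; exact not_not.2 hi)
  rw [Nat.card_Ioo, show p + b - p - 1 = b - 1 by omega] at h
  rw [← h]
  congr 1
  ext z
  simp only [mem_filter, mem_univ, true_and, mem_Ioo]
  constructor
  · intro h i _ hi
    exact h i (by omega)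
  · intro h i hi
    by_cases hin : i ∈ Icc 1 n
    · exact h i hin (by omega)
    · rw [entry_eq_none_iff.2 hin, entry_eq_none_iff.2 hin]

theorem cut_eq_none_iff {x : Fin n → Fin q} {s i : ℕ} (hs : s ∈ Icc 1 (n - b + 1)) (hb : b ≤ n) :
    cut b s (entry x) i = none ↔ i ∉ Icc 1 (n - b) := by
  rw [mem_Icc] at hs
  simp only [cut]
  split_ifs <;> rw [entry_eq_none_iff, mem_Icc, mem_Icc] <;> omega

open Classical in
theorem card_cut_eq (x : Fin n → Fin q) {s t : ℕ} (hb : b ≤ n) (hs : s ∈ Icc 1 (n - b + 1))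
    (ht : t ∈ Icc 1 (n - b + 1)) :
    #{z : Fin n → Fin q | cut b s (entry x) = cut b t (entry z)} = q ^ b := by
  have hY := fun i => @cut_eq_none_iff q n b x s i hs hb
  have hZ := fun (z : Fin n → Fin q) i => @cut_eq_none_iff q n b z t i ht hb
  set Y := cut b s (entry x)
  rw [mem_Icc] at ht
  have h := card_words_prescribed (n := n) (W := fun i => if i < t then Y i else Y (i - b))
    (S := Ico t (t + b))
    (fun i hi => by rw [mem_Ico] at hi; rw [mem_Icc]; omega)
    (fun i hi hi' => by
      rw [mem_Icc] at hi
      rw [mem_Ico] at hi'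
      split_ifs <;> rw [Ne, hY, mem_Icc] <;> omega)
  rw [Nat.card_Ico, Nat.add_sub_cancel_left] at h
  rw [← h]
  congr 1
  ext z
  simp only [mem_filter, mem_univ, true_and, mem_Ico]
  constructor
  · intro h i hi hi'
    rw [h]
    simp only [cut]
    grind
  · intro h
    funext i
    by_cases hin : i ∈ Icc 1 (n - b)
    · rw [mem_Icc] at hin
      simp only [cut]
      split_ifs with hit
      · rw [h i (by rw [mem_Icc]; omega) (by omega), if_pos hit]
      · rw [h (i + b) (by rw [mem_Icc]; omega) (by omega), if_neg (by omega), Nat.add_sub_cancel]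
    · rw [(hY i).2 hin, (hZ z i).2 hin]

open Classical in
theorem card_cut_eq_and_cut_succ_eq (x : Fin n → Fin q) {s t : ℕ} (hb1 : 1 ≤ b) (hb : b ≤ n)
    (hs : s ∈ Icc 1 (n - b + 1)) (ht : t ∈ Icc 1 (n - b)) :
    #{z : Fin n → Fin q | cut b s (entry x) = cut b t (entry z) ∧
      cut b s (entry x) = cut b (t + 1) (entry z)} = q ^ (b - 1) := by
  have hY := fun i => @cut_eq_none_iff q n b x s i hs hb
  rw [mem_Icc] at ht
  have hZ := fun (z : Fin n → Fin q) i =>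
    @cut_eq_none_iff q n b z t i (by rw [mem_Icc]; omega) hb
  set Y := cut b s (entry x)
  -- The two equations together force `z` to carry the letter `Y t` at both `t` and `t + b`, leaving
  -- only the `b - 1` positions strictly between them free.
  have h := card_words_prescribed (n := n) (W := fun i => if i ≤ t then Y i else Y (i - b))
    (S := Ioo t (t + b))
    (fun i hi => by rw [mem_Ioo] at hi; rw [mem_Icc]; omega)
    (fun i hi hi' => by
      rw [mem_Icc] at hi
      rw [mem_Ioo] at hi'
      split_ifs <;> rw [Ne, hY, mem_Icc] <;> omega)
  rw [Nat.card_Ioo, show t + b - t - 1 = b - 1 by omega] at h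
  rw [← h]
  congr 1
  ext z
  simp only [mem_filter, mem_univ, true_and, mem_Ioo]
  constructor
  · rintro ⟨h1, h2⟩ i hi hi'
    split_ifs with hit
    · rw [h2]
      simp only [cut]
      grind
    · rw [h1]
      simp only [cut]
      grind
  · intro h
    have h1 : Y = cut b t (entry z) := by
      funext i
      by_cases hin : i ∈ Icc 1 (n - b)
      · rw [mem_Icc] at hin
        simp only [cut]
        split_ifs with hit
        · rw [h i (by rw [mem_Icc]; omega) (by omega), if_pos (by omega)]
        · rw [h (i + b) (by rw [mem_Icc]; omega) (by omega), if_neg (by omega),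
            Nat.add_sub_cancel]
      · rw [(hY i).2 hin, (hZ z i).2 hin]
    refine ⟨h1, h1.trans ((cut_eq_cut_iff (by omega)).2 fun i h2 h3 => ?_)⟩
    obtain rfl : i = t := by omega
    rw [h i (by rw [mem_Icc]; omega) (by omega), h (i + b) (by rw [mem_Icc]; omega) (by omega),
      if_pos le_rfl, if_neg (by omega), Nat.add_sub_cancel]

theorem sum_card_filter_comm {α β : Type*} (s : Finset α) (t : Finset β) (r : α → β → Prop)
    [∀ a b, Decidable (r a b)] :
    ∑ a ∈ s, #{b ∈ t | r a b} = ∑ b ∈ t, #{a ∈ s | r a b} :=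
  sum_card_bipartiteAbove_eq_sum_card_bipartiteBelow r

-- For fixed `z` the positions `t` whose deletion gives the prescribed word form an interval. If it
-- is non-empty, it has one more element than it has adjacent pairs; summing over `z` counts each
-- word once.
open Classical in
theorem card_cutShared_words (x : Fin n → Fin q) {s : ℕ} (hb1 : 1 ≤ b) (hb : b ≤ n)
    (hs : s ∈ Icc 1 (n - b + 1)) :
    #{z : Fin n → Fin q | CutShared b (n - b) (entry x) (entry z) s} + (n - b) * q ^ (b - 1) =
      (n - b + 1) * q ^ b := by
  have key : ∀ z : Fin n → Fin q,
      #{t ∈ Icc 1 (n - b + 1) | cut b s (entry x) = cut b t (entry z)} =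
      (if CutShared b (n - b) (entry x) (entry z) s then 1 else 0) +
      #{t ∈ Icc 1 (n - b) | cut b s (entry x) = cut b t (entry z) ∧
        cut b s (entry x) = cut b (t + 1) (entry z)} := by
    intro z
    split_ifs with h
    -- With every position in `J`, each `t` is its own class and the closure condition is vacuous.
    · have := card_filter_of_convex (m := n - b) (J := Icc 1 (n - b))
        (T := fun t => cut b s (entry x) = cut b t (entry z)) Subset.rfl
        (fun r u r' _ h1 h2 _ e1 e2 => by
          have e3 := (cut_eq_cut_iff (h1.trans h2)).1 (e1.symm.trans e2)
          exact e1.trans ((cut_eq_cut_iff h1).2 fun i i1 i2 => e3 i i1 (by omega)))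
        h (fun i hi hi' => absurd hi hi')
      rw [← this]
      congr 2
      ext i
      simp only [mem_insert, mem_Icc]
      omega
    · rw [zero_add, filter_false_of_mem, filter_false_of_mem]
      · intro t ht h1
        rw [mem_Icc] at ht
        exact h ⟨t, by rw [mem_Icc]; omega, h1.1⟩
      · exact fun t ht h1 => h ⟨t, ht, h1⟩
  have hsum := sum_congr (rfl : (univ : Finset (Fin n → Fin q)) = univ) fun z _ => key z
  rw [sum_add_distrib, ← card_filter,
    sum_card_filter_comm univ _ fun z t => cut b s (entry x) = cut b t (entry z),
    sum_card_filter_comm univ _ fun z t => cut b s (entry x) = cut b t (entry z) ∧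
      cut b s (entry x) = cut b (t + 1) (entry z),
    sum_congr rfl fun t ht => card_cut_eq x hb hs ht,
    sum_congr rfl fun t ht => card_cut_eq_and_cut_succ_eq x hb1 hb hs ht, sum_const, sum_const,
    Nat.card_Icc, Nat.card_Icc, smul_eq_mul, smul_eq_mul, Nat.add_sub_cancel,
    Nat.add_sub_cancel] at hsum
  exact hsum.symm

end Words

/-! ### Runs, swaps and the final double count -/

section Counting

variable {q n b : ℕ}

/-- The last jump before `j`, or `0` if there is none. -/
noncomputable def lastJumpBefore {β : Type*} (b m : ℕ) (X : ℕ → β) (j : ℕ) : ℕ :=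
  {i ∈ jumps b m X | i < j}.sup id

theorem le_lastJumpBefore {β : Type*} {m i j : ℕ} {X : ℕ → β} (hi : i ∈ jumps b m X)
    (hij : i < j) : i ≤ lastJumpBefore b m X j :=
  le_sup (f := id) (mem_filter.2 ⟨hi, hij⟩)

theorem lastJumpBefore_lt {β : Type*} (b m : ℕ) (X : ℕ → β) {j : ℕ} (hj : 1 ≤ j) :
    lastJumpBefore b m X j < j :=
  (Finset.sup_lt_iff (show ⊥ < j from hj)).2 fun _ hi => (mem_filter.1 hi).2

theorem lastJumpBefore_mem {β : Type*} {m j : ℕ} {X : ℕ → β}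
    (h : 1 ≤ lastJumpBefore b m X j) : lastJumpBefore b m X j ∈ jumps b m X := by
  have hne : {i ∈ jumps b m X | i < j}.Nonempty := by
    by_contra hcon
    rw [not_nonempty_iff_eq_empty] at hcon
    rw [lastJumpBefore, hcon, sup_empty] at h
    exact absurd h (by simp)
  obtain ⟨i, hi, e⟩ := exists_mem_eq_sup _ hne id
  rw [lastJumpBefore, e]
  exact (mem_filter.1 hi).1

/-- A run is stopped on each side by a jump or by the end of the word. The class end `j` matches the
run whose last position is `j + b - 1` and which starts just after the preceding jump; the default
`0` of `lastJumpBefore` gives start `1`. -/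
theorem runCount_eq (x : Fin n → Fin q) (hb : 1 ≤ b) (hn : b ≤ n) :
    runCount b x = #(jumps b (n - b) (entry x)) + 1 := by
  classical
  set J := jumps b (n - b) (entry x) with hJ
  have hmem : ∀ i, 1 ≤ i → i + b ≤ n → i ∉ J → entry x i = entry x (i + b) := by
    intro i h1 h2 h3
    by_contra h4
    exact h3 (mem_jumps.2 ⟨by omega, h4⟩)
  have hbd : ∀ j ∈ insert (n - b + 1) J, 1 ≤ j ∧ j ≤ n - b + 1 := by
    intro j hj
    rcases mem_insert.1 hj with rfl | hj
    · omega
    · have := (mem_jumps.1 hj).1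
      omega
  rw [← card_insert_of_notMem (a := n - b + 1) (s := J)
    (fun h => by have := (mem_jumps.1 h).1; omega), runCount]
  symm
  refine card_bij (fun j _ => (lastJumpBefore b (n - b) (entry x) j + 1, j + b - 1)) ?_ ?_ ?_
  · intro j hj
    obtain ⟨h1, h2⟩ := hbd j hj
    have h3 := lastJumpBefore_lt b (n - b) (entry x) h1
    simp only [mem_filter, mem_product, mem_Icc]
    refine ⟨by omega, by omega, ?_, ?_⟩
    · intro t ht1 ht2
      by_contra ht3
      have := le_lastJumpBefore (j := j) (mem_jumps.2 ⟨(by omega : 1 ≤ t ∧ t ≤ n - b), ht3⟩)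
        (by omega)
      omega
    · intro s' e' hs1 hs2 he1 he2 hp
      constructor
      · by_contra hne
        have h4 := lastJumpBefore_mem (b := b) (m := n - b) (X := entry x) (j := j) (by omega)
        exact (mem_jumps.1 h4).2 (hp _ (by omega) (by omega))
      · by_contra hne
        rcases mem_insert.1 hj with h4 | h4
        · omega
        · exact (mem_jumps.1 h4).2 (hp j (by omega) (by omega))
  · intro i hi j hj hij
    have := hbd i hi
    have := hbd j hj
    have := (Prod.ext_iff.1 hij).2
    dsimp only at this
    omega
  · rintro ⟨s, e⟩ hse
    obtain ⟨-, ⟨h1, h2, h3⟩, hp, hmax⟩ := mem_filter.1 hse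
    dsimp only at h1 h2 h3 hp hmax
    -- An interval of fewer than `b` positions can be lengthened and stay periodic for trivial
    -- reasons, so a run has length at least `b`.
    have hlen : s + b ≤ e + 1 := by
      by_contra hcon
      by_cases hen : e < n
      · have := hmax s (e + 1) h1 le_rfl (by omega) hen (fun t _ _ => by omega)
        omega
      · have := hmax (s - 1) e (by omega) (by omega) le_rfl h3 (fun t _ _ => by omega)
        omega
    have hj : e + 1 - b ∈ insert (n - b + 1) J := by
      by_contra hcon
      rw [mem_insert, not_or] at hcon
      have := hmax s (e + 1) h1 le_rfl (by omega) (by omega) (fun t ht1 ht2 => by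
        by_cases hte : t + b ≤ e
        · exact hp t ht1 hte
        · obtain rfl : t = e + 1 - b := by omega
          exact hmem _ (by omega) (by omega) hcon.2)
      omega
    refine ⟨e + 1 - b, hj, ?_⟩
    have hle : lastJumpBefore b (n - b) (entry x) (e + 1 - b) < s := by
      by_contra hcon
      have h4 := lastJumpBefore_mem (b := b) (m := n - b) (X := entry x) (j := e + 1 - b)
        (by omega)
      have h5 := lastJumpBefore_lt b (n - b) (entry x) (j := e + 1 - b) (by omega)
      exact (mem_jumps.1 h4).2 (hp _ (by omega) (by omega))
    have hge : s ≤ lastJumpBefore b (n - b) (entry x) (e + 1 - b) + 1 := by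
      by_contra hcon
      have := hmax (s - 1) e (by omega) (by omega) le_rfl h3 (fun t ht1 ht2 => by
        by_cases hts : s ≤ t
        · exact hp t hts ht2
        · obtain rfl : t = s - 1 := by omega
          refine hmem _ (by omega) (by omega) fun hJ' => ?_
          have := le_lastJumpBefore (j := e + 1 - b) hJ' (by omega)
          omega)
      omega
    ext <;> dsimp only <;> omega

-- When `t` and `t + 2 * b` both lie in `[p, p' + b]`, a swap prescribes the letter at `t + b`
-- twice, as `X t` and as `X (t + 2 * b)`; hence the periodicity condition. The free positions are
-- those of `(p', p + b)`; the truncated exponent is `0` when the blocks are adjacent or overlap.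
open Classical in
theorem card_isSwap (x : Fin n → Fin q) {P : ℕ × ℕ} (hP : P ∈ jumpPairs b (n - b) (entry x)) :
    #{z : Fin n → Fin q | IsSwap b (entry x) (entry z) P.1 P.2} =
      if SubstringPeriodic (2 * b) x P.1 (P.2 + b) then q ^ (P.1 + b - P.2 - 1) else 0 := by
  obtain ⟨p, p'⟩ := P
  obtain ⟨⟨hp, hp'⟩, hpp⟩ := mem_jumpPairs.1 hP
  dsimp only at hp hp' hpp ⊢
  have hp := (mem_jumps.1 hp).1
  have hp' := (mem_jumps.1 hp').1
  split_ifs with hper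
  · have h := card_words_prescribed (n := n) (S := Ioo p' (p + b))
      (W := fun i => if i < p then entry x i else if i ≤ p' then entry x (i + b) else
        if i ≤ p' + b then entry x (i - b) else entry x i)
      (fun i hi => by rw [mem_Ioo] at hi; rw [mem_Icc]; omega)
      (fun i hi hi' => by
        rw [mem_Icc] at hi
        rw [mem_Ioo] at hi'
        split_ifs <;> rw [Ne, entry_eq_none_iff, mem_Icc] <;> omega)
    rw [Nat.card_Ioo] at h
    rw [← h]
    congr 1
    ext z
    simp only [mem_filter, mem_univ, true_and, mem_Ioo]
    constructor
    · rintro ⟨h1, h2, h3⟩ i hi hi'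
      split_ifs with i1 i2 i3
      · exact h1 i i1
      · exact (h2 i (by omega) i2).1
      · have := (h2 (i - b) (by omega) (by omega)).2
        rwa [Nat.sub_add_cancel (by omega)] at this
      · exact h3 i (by omega)
    · intro h
      refine ⟨fun i hi => ?_, fun i i1 i2 => ⟨?_, ?_⟩, fun i hi => ?_⟩
      · by_cases hin : i ∈ Icc 1 n
        · rw [h i hin (by omega), if_pos hi]
        · rw [entry_eq_none_iff.2 hin, entry_eq_none_iff.2 hin]
      · rw [h i (by rw [mem_Icc]; omega) (by omega), if_neg (by omega), if_pos i2]
      · rw [h (i + b) (by rw [mem_Icc]; omega) (by omega), if_neg (by omega)]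
        split_ifs with i3 i4
        · have := hper i i1 (by omega)
          rw [this]
          congr 1
          omega
        · rw [Nat.add_sub_cancel]
        · omega
      · by_cases hin : i ∈ Icc 1 n
        · rw [h i hin (by omega), if_neg (by omega), if_neg (by omega), if_neg (by omega)]
        · rw [entry_eq_none_iff.2 hin, entry_eq_none_iff.2 hin]
  · rw [card_eq_zero, filter_eq_empty_iff]
    rintro z - ⟨h1, h2, h3⟩
    refine hper fun t t1 t2 => ?_
    rw [← (h2 t t1 (by omega)).2, (h2 (t + b) (by omega) (by omega)).1]
    congr 1
    omega

theorem fCount_zero (x : Fin n → Fin q) : fCount b 0 x = #(jumps b (n - b) (entry x)) := by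
  simp [fCount, jumps]

open Classical in
theorem card_jumpPairs_sub_eq (x : Fin n → Fin q) (j : ℕ) :
    #{P ∈ jumpPairs b (n - b) (entry x) | P.2 - P.1 = j} = fCount b j x := by
  symm
  refine card_bij (fun i _ => (i, i + j)) ?_ ?_ ?_
  · intro i hi
    simp only [mem_filter, mem_Icc] at hi
    simp only [mem_filter, mem_jumpPairs, mem_jumps]
    exact ⟨⟨⟨⟨by omega, hi.2.1⟩, by omega, hi.2.2⟩, by omega⟩, by omega⟩
  · intro i _ i' _ h
    exact (Prod.ext_iff.1 h).1
  · rintro ⟨p, p'⟩ h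
    simp only [mem_filter, mem_jumpPairs, mem_jumps] at h
    obtain ⟨⟨⟨⟨h1, h2⟩, h3, h4⟩, h5⟩, h6⟩ := h
    obtain rfl : p' = p + j := by omega
    refine ⟨p, ?_, rfl⟩
    simp only [mem_filter, mem_Icc]
    exact ⟨by omega, h2, h4⟩

open Classical in
theorem card_jumpPairs_far_periodic (x : Fin n → Fin q) :
    #{P ∈ jumpPairs b (n - b) (entry x) |
      P.1 + b ≤ P.2 ∧ SubstringPeriodic (2 * b) x P.1 (P.2 + b)} =
      ∑ i ∈ Icc 1 (n - 2 * b), gCount b i x := by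
  rw [card_eq_sum_card_fiberwise (f := Prod.fst) (t := Icc 1 (n - 2 * b))]
  · refine sum_congr rfl fun i hi => ?_
    symm
    refine card_bij (fun j _ => (i, j)) ?_ ?_ ?_
    · intro j hj
      rw [mem_Icc] at hi
      simp only [mem_filter, mem_Icc] at hj
      simp only [mem_filter, mem_jumpPairs, mem_jumps]
      exact ⟨⟨⟨⟨⟨by omega, hj.2.1⟩, by omega, hj.2.2.1⟩, by omega⟩, hj.1.1, hj.2.2.2⟩, trivial⟩
    · intro j _ j' _ h
      exact (Prod.ext_iff.1 h).2
    · rintro ⟨p, p'⟩ h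
      simp only [mem_filter, mem_jumpPairs, mem_jumps] at h
      obtain ⟨⟨⟨⟨⟨h1, h2⟩, h3, h4⟩, h5⟩, h6, h7⟩, rfl⟩ := h
      refine ⟨p', ?_, rfl⟩
      simp only [mem_filter, mem_Icc]
      exact ⟨by omega, h2, h4, h7⟩
  · rintro ⟨p, p'⟩ h
    simp only [coe_filter, Set.mem_ofPred_eq, mem_jumpPairs, mem_jumps] at h
    simp only [coe_Icc, Set.mem_Icc]
    omega

open Classical in
theorem sum_card_isSwap (x : Fin n → Fin q) (hb : 1 ≤ b) :
    ∑ P ∈ jumpPairs b (n - b) (entry x),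
        #{z : Fin n → Fin q | IsSwap b (entry x) (entry z) P.1 P.2} =
      q ^ (b - 1) * #(jumps b (n - b) (entry x)) +
        ∑ j ∈ Icc 1 (b - 1), q ^ (b - j - 1) * fCount b j x +
        ∑ i ∈ Icc 1 (n - 2 * b), gCount b i x := by
  rw [sum_congr rfl fun P hP => card_isSwap x hP,
    ← sum_filter_add_sum_filter_not _ (fun P : ℕ × ℕ => P.2 < P.1 + b)]
  congr 1
  · rw [← sum_fiberwise_of_maps_to (g := fun P : ℕ × ℕ => P.2 - P.1) (t := range b)]
    · have key : ∀ j ∈ range b,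
          (∑ P ∈ {P ∈ {P ∈ jumpPairs b (n - b) (entry x) | P.2 < P.1 + b} | P.2 - P.1 = j},
            if SubstringPeriodic (2 * b) x P.1 (P.2 + b) then q ^ (P.1 + b - P.2 - 1) else 0) =
          q ^ (b - j - 1) * fCount b j x := by
        intro j hj
        rw [mem_range] at hj
        rw [← card_jumpPairs_sub_eq x j, filter_filter, mul_comm (q ^ _), card_eq_sum_ones,
          sum_mul]
        refine sum_congr (filter_congr fun P hP => ?_) fun P hP => ?_
        · have := (mem_jumpPairs.1 hP).2
          omega
        · rw [mem_filter] at hP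
          have := (mem_jumpPairs.1 hP.1).2
          -- The substring has `p' - p + b + 1 ≤ 2 * b` letters, so its periodicity is automatic.
          rw [if_pos (show SubstringPeriodic _ x _ _ from fun t t1 t2 => by omega), one_mul]
          congr 1
          omega
      rw [sum_congr rfl key, range_eq_Ico, sum_eq_sum_Ico_succ_bot hb, Nat.sub_zero, fCount_zero]
      rfl
    · intro P hP
      rw [mem_filter] at hP
      have := (mem_jumpPairs.1 hP.1).2
      rw [mem_range]
      omega
  · rw [← card_jumpPairs_far_periodic, ← filter_filter, card_filter]
    refine sum_congr (filter_congr fun P _ => not_lt) fun P hP => ?_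
    rw [mem_filter] at hP
    rw [show P.1 + b - P.2 - 1 = 0 by omega, pow_zero]

-- Double count of the pairs of a word and a class whose deletion result it shares. The factor `2`
-- joins the agreements outside `(p, p + b)` to the swaps with `p = p'`. Negative terms are moved
-- across to avoid truncated subtraction.
open Classical in
theorem card_levenshteinBall_one (x : Fin n → Fin q) (hb : 1 ≤ b) (hn : b ≤ n) :
    (#(jumps b (n - b) (entry x)) + 1) * ((n - b + 1) * q ^ b) =
      (levenshteinBall b 1 x).ncard +
        (#(jumps b (n - b) (entry x)) + 1) * ((n - b) * q ^ (b - 1)) +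
        2 * (q ^ (b - 1) * #(jumps b (n - b) (entry x))) +
        ∑ j ∈ Icc 1 (b - 1), q ^ (b - j - 1) * fCount b j x +
        ∑ i ∈ Icc 1 (n - 2 * b), gCount b i x := by
  have hball : (levenshteinBall b 1 x).ncard = ∑ z : Fin n → Fin q,
      if ∃ s ∈ Icc 1 (n - b + 1), CutShared b (n - b) (entry x) (entry z) s then 1 else 0 := by
    refine Eq.trans ?_ (card_filter _ _)
    rw [← Set.ncard_coe_finset]
    congr 1
    ext z
    rw [mem_levenshteinBall_one hn]
    simp
  have hR : #(insert (n - b + 1) (jumps b (n - b) (entry x))) =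
      #(jumps b (n - b) (entry x)) + 1 :=
    card_insert_of_notMem fun h => by have := (mem_jumps.1 h).1; omega
  have key : ∀ z : Fin n → Fin q,
      #{s ∈ insert (n - b + 1) (jumps b (n - b) (entry x)) |
        CutShared b (n - b) (entry x) (entry z) s} =
      (if ∃ s ∈ Icc 1 (n - b + 1), CutShared b (n - b) (entry x) (entry z) s then 1 else 0) +
        #{p ∈ jumps b (n - b) (entry x) | AgreeOutside b (entry x) (entry z) p p} +
        #{P ∈ jumpPairs b (n - b) (entry x) | IsSwap b (entry x) (entry z) P.1 P.2} := by
    intro z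
    convert card_cutShared b (n - b) (entry x) (entry z)
  have hsum := sum_congr (rfl : (univ : Finset (Fin n → Fin q)) = univ) fun z _ => key z
  rw [sum_add_distrib, sum_add_distrib, ← hball,
    sum_card_filter_comm univ _ fun (z : Fin n → Fin q) s =>
      CutShared b (n - b) (entry x) (entry z) s,
    sum_card_filter_comm univ _ fun (z : Fin n → Fin q) p =>
      AgreeOutside b (entry x) (entry z) p p,
    sum_card_filter_comm univ _ fun (z : Fin n → Fin q) (P : ℕ × ℕ) =>
      IsSwap b (entry x) (entry z) P.1 P.2, sum_card_isSwap x hb,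
    sum_congr rfl fun p hp => card_agreeOutside x hp, sum_const, smul_eq_mul] at hsum
  have hI : ∑ s ∈ insert (n - b + 1) (jumps b (n - b) (entry x)),
      (#{z : Fin n → Fin q | CutShared b (n - b) (entry x) (entry z) s} +
        (n - b) * q ^ (b - 1)) =
      (#(jumps b (n - b) (entry x)) + 1) * ((n - b + 1) * q ^ b) := by
    rw [← hR]
    refine sum_eq_card_nsmul fun s hs => card_cutShared_words x hb hn ?_
    rw [mem_Icc]
    rcases mem_insert.1 hs with rfl | hs
    · omega
    · have := (mem_jumps.1 hs).1
      omega
  rw [← hI, sum_add_distrib, hsum, sum_const, hR, smul_eq_mul]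
  ring

end Counting

theorem theorem2 (q n b : ℕ) (hb : 1 ≤ b) (hn : b + 1 ≤ n) (x : Fin n → Fin q) :
    ((levenshteinBall b 1 x).ncard : ℤ) =
      (q : ℤ) ^ (b - 1) * (((n : ℤ) - b + 1) * ((q : ℤ) - 1) - 1) * (runCount b x : ℤ)
        + 2 * (q : ℤ) ^ (b - 1)
        - ∑ j ∈ Icc 1 (b - 1), (q : ℤ) ^ (b - j - 1) * (fCount b j x : ℤ)
        - ∑ i ∈ Icc 1 (n - 2 * b), (gCount b i x : ℤ) := by
  have h := card_levenshteinBall_one x hb (by omega)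
  rw [runCount_eq x hb (by omega)]
  -- With `b = c + 1`, the power `q ^ b` splits as `q ^ c * q`, and the identity becomes linear in
  -- `h`.
  obtain ⟨c, rfl⟩ := Nat.exists_eq_add_of_le' hb
  zify at h
  rw [Nat.cast_sub (by omega : c + 1 ≤ n)] at h
  push_cast at h ⊢
  rw [pow_succ] at h
  linear_combination -h
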